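/- Let $m,n$ be positive integers and let $\tau_{m,n}$ be the ordinal sum of an $m$-element antichain and an $n$-element antichain, that is, the partial order on $E=\{1,\dots,m\}\sqcup\{1',\dots,n'\}$ whose only strict relations are $i\prec j'$ for $1\le i\le m$, $1\le j\le n$. Let $\mathcal{Q}_{m,n}\subset\mathbb{R}^E$ be its preorder polytope, defined by $x_e\ge 0$ for all $e\in E$ and $\sum_{e\in I}x_e\le |I|$ for every order ideal $I$ of $\tau_{m,n}$, and let $h_{m,n}(t)=\sum_{i=0}^{m+n}h_i t^i$, where $h_i$ is the number of lattice points of $\mathcal{Q}_{m,n}$ with exactly $i$ nonzero coordinates. Then the number of lattice points of $\mathcal{Q}_{m,n}$ is \[ h_{m,n}(1)=\sum_{k=0}^m\sum_{\ell=0}^n\binom{k+\ell}{k}\binom mk\binom n\ell, \] and \[ h_{m,n}(t)=\sum_{k=0}^m\sum_{\ell=0}^n\binom{k+\ell}{k}\binom mk\binom n\ell\, t^{m-k+\ell}=\sum_{i=0}^{\min(m,n)}\binom mi\binom ni\, t^i(1+t)^{m+n-2i}. \] In particular, $h_{m,n}(t)$ is palindromic, meaning that $h_i=h_{m+n-i}$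 for $0\le i\le m+n$, and $\gamma$-positive, meaning that $h_{m,n}(t)=\sum_{i=0}^{\lfloor (m+n)/2\rfloor}\gamma_i t^i(1+t)^{m+n-2i}$ for some nonnegative integers $\gamma_i$. Moreover, all complex roots of $h_{m,n}(t)$ are real. -/

import Mathlib

open Polynomial

namespace PreorderPolytope

/-- A copy of the type `α`, ordered as an antichain: `a ≤ b` only if `a = b`. -/
def Antichain (α : Type*) : Type _ := α

instance {α : Type*} [Fintype α] : Fintype (Antichain α) := inferInstanceAs (Fintype α)

instance {α : Type*} [DecidableEq α] : DecidableEq (Antichain α) :=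
  inferInstanceAs (DecidableEq α)

instance {α : Type*} : PartialOrder (Antichain α) where
  le a b := a = b
  le_refl _ := rfl
  le_trans _ _ _ h₁ h₂ := Eq.trans h₁ h₂
  le_antisymm _ _ h _ := h

/-- The ordinal sum of an `m`-element antichain (below) and an `n`-element antichain (above).
Mathlib's lexicographic sum `α ⊕ₗ β` of orders puts every element of `α` below every element
of `β` and keeps the given orders inside `α` and inside `β`. -/
abbrev AntichainSum (m n : ℕ) : Type := Antichain (Fin m) ⊕ₗ Antichain (Fin n)

section Polytope

/-- The preorder polytope in `ℝ^E` of a preorder on the finite set `E`: all coordinates are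
nonnegative, and the sum of the coordinates over each order ideal is at most its cardinality. -/
def polytope (E : Type*) [Preorder E] : Set (E → ℝ) :=
  {x | (∀ e, 0 ≤ x e) ∧
    ∀ I : Finset E, IsLowerSet (I : Set E) → ∑ e ∈ I, x e ≤ (I.card : ℝ)}

/-- The lattice points of the preorder polytope. -/
def latticePoints (E : Type*) [Preorder E] : Set (E → ℤ) :=
  {a | (fun e => (a e : ℝ)) ∈ polytope E}

/-- The number of lattice points of the preorder polytope with exactly `i` nonzero
coordinates. -/
noncomputable def hVector (E : Type*) [Preorder E] [Fintype E] (i : ℕ) : ℕ :=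
  {a ∈ latticePoints E | (Finset.univ.filter fun e => a e ≠ 0).card = i}.ncard

/-- The `h`-polynomial of a preorder on the finite set `E`. -/
noncomputable def hPolynomial (E : Type*) [Preorder E] [Fintype E] : ℤ[X] :=
  ∑ i ∈ Finset.range (Fintype.card E + 1), C (hVector E i : ℤ) * X ^ i

end Polytope

/-- The coefficient sequence of `p` in degrees `0, …, d` is symmetric. -/
def IsPalindromic (d : ℕ) (p : ℤ[X]) : Prop :=
  ∀ i ≤ d, p.coeff i = p.coeff (d - i)

/-- `p` is a combination of the polynomials `t ^ i * (1 + t) ^ (d - 2 * i)`, `0 ≤ i ≤ ⌊d / 2⌋`,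
with nonnegative integer coefficients. -/
def IsGammaPositive (d : ℕ) (p : ℤ[X]) : Prop :=
  ∃ γ : ℕ → ℕ,
    p = ∑ i ∈ Finset.range (d / 2 + 1), C (γ i : ℤ) * X ^ i * (1 + X) ^ (d - 2 * i)

/-- All complex roots of `p` are real. -/
def IsRealRooted (p : ℤ[X]) : Prop :=
  ∀ z : ℂ, aeval z p = 0 → z.im = 0

end PreorderPolytope

/-! Lower coordinates of a lattice point are 0 or 1. Let `S` be the zero set below and `T` the
support above. The remaining inequalities say exactly that the excesses `a_j - 1`, `j ∈ T`, sum to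
at most `|S|`. With a slack variable these are weak compositions of `|S| = k` into `|T| + 1 = l + 1`
parts, `(k + l).choose k` in number, and the point has `m - k + l` nonzero coordinates. This gives
the double sum.

Vandermonde splits `(k + l).choose k` as `∑ i, k.choose i * l.choose i`; for fixed `i` the sums over
`k` and `l` separate and give the γ-expansion, hence palindromicity.

For real roots, write `h(t) = (1 + t)^(m + n) * P(s)` with `s = t / (1 + t)^2` and `P(s) = ∑ i,
m.choose i * n.choose i * s^i`. Setting `s = (x + 1) / x` turns `x^n * P(s)` into the `m`-th
derivative of `(x + 1)^m * x^n` up to a constant. By Gauss–Lucas `x ∈ [-1, 0]`, so `s ≤ 0`, and then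
the quadratic `t = s * (1 + t)^2` has only real solutions. -/

/-! ### Binomial identities behind the γ-expansion -/

/-- Terms beyond `min k l` vanish; leaving `N` free lets one range serve all `k ≤ m`, `l ≤ n`, so
that the sum over `i` can be moved outside. -/
theorem choose_add_eq_sum_choose_mul_choose {k l N : ℕ} (hN : min k l ≤ N) :
    (k + l).choose k = ∑ i ∈ Finset.range (N + 1), k.choose i * l.choose i := by
  have h : (k + l).choose k = ∑ i ∈ Finset.range (k + 1), k.choose i * l.choose i := by
    rw [Nat.add_choose_eq, Finset.Nat.sum_antidiagonal_eq_sum_range_succ_mk,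
      ← Finset.sum_range_reflect]
    refine Finset.sum_congr rfl fun i hi => ?_
    have hi : i ≤ k := Nat.lt_succ_iff.mp (Finset.mem_range.mp hi)
    rw [Nat.succ_sub_one, Nat.sub_sub_self hi, Nat.choose_symm hi]
  have zero : ∀ i, min k l < i → k.choose i * l.choose i = 0 := by
    intro i hi
    rcases min_lt_iff.mp hi with hi | hi <;> simp [Nat.choose_eq_zero_of_lt hi]
  rw [h]
  trans ∑ i ∈ Finset.range (min k l + 1), k.choose i * l.choose i
  · symm
    refine Finset.sum_subset (Finset.range_subset_range.mpr (by omega)) fun i _ hi => zero i ?_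
    rw [Finset.mem_range] at hi
    omega
  · refine Finset.sum_subset (Finset.range_subset_range.mpr (by omega)) fun i _ hi => zero i ?_
    rw [Finset.mem_range] at hi
    omega

section CommSemiring

variable {R : Type*} [CommSemiring R]

/-- Choosing an `i`-subset inside a `k`-subset amounts to choosing the `i`-subset first; then put `k
= i + j`. -/
theorem sum_range_choose_mul_choose_mul (f : ℕ → R) {m i : ℕ} (hi : i ≤ m) :
    ∑ k ∈ Finset.range (m + 1), (m.choose k * k.choose i : R) * f k =
      m.choose i * ∑ j ∈ Finset.range (m - i + 1), ((m - i).choose j : R) * f (i + j) := by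
  obtain ⟨d, rfl⟩ := Nat.exists_eq_add_of_le hi
  rw [Nat.add_sub_cancel_left, add_assoc, Finset.sum_range_add, Finset.mul_sum,
    Finset.sum_eq_zero, zero_add]
  · refine Finset.sum_congr rfl fun j _ => ?_
    have h := Nat.choose_mul (n := i + d) (k := i + j) (s := i) (Nat.le_add_right _ _)
    rw [Nat.add_sub_cancel_left, Nat.add_sub_cancel_left] at h
    have h' := congrArg (Nat.cast : ℕ → R) h
    push_cast at h'
    rw [h', mul_assoc]
  · intro k hk
    simp [Nat.choose_eq_zero_of_lt (Finset.mem_range.mp hk)]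

theorem sum_range_choose_mul_choose_mul_pow (x : R) {m i : ℕ} (hi : i ≤ m) :
    ∑ k ∈ Finset.range (m + 1), (m.choose k * k.choose i : R) * x ^ k =
      m.choose i * x ^ i * (1 + x) ^ (m - i) := by
  rw [sum_range_choose_mul_choose_mul _ hi, add_comm 1 x, add_pow, mul_assoc, Finset.mul_sum,
    Finset.mul_sum, Finset.mul_sum]
  refine Finset.sum_congr rfl fun j _ => ?_
  rw [pow_add]
  ring

theorem sum_range_choose_mul_choose_mul_pow_sub (x : R) {m i : ℕ} (hi : i ≤ m) :
    ∑ k ∈ Finset.range (m + 1), (m.choose k * k.choose i : R) * x ^ (m - k) =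
      m.choose i * (1 + x) ^ (m - i) := by
  rw [sum_range_choose_mul_choose_mul _ hi, add_pow]
  congr 1
  refine Finset.sum_congr rfl fun j _ => ?_
  rw [one_pow, one_mul, mul_comm, Nat.sub_sub]

theorem sum_choose_mul_pow_eq_sum_mul_one_add_pow (x : R) (m n : ℕ) :
    ∑ k ∈ Finset.range (m + 1), ∑ l ∈ Finset.range (n + 1),
        (((k + l).choose k * m.choose k * n.choose l : ℕ) : R) * x ^ (m - k + l) =
      ∑ i ∈ Finset.range (min m n + 1),
        ((m.choose i * n.choose i : ℕ) : R) * x ^ i * (1 + x) ^ (m + n - 2 * i) := by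
  trans ∑ k ∈ Finset.range (m + 1), ∑ l ∈ Finset.range (n + 1),
      ∑ i ∈ Finset.range (min m n + 1), ((m.choose k * k.choose i : R) * x ^ (m - k)) *
        ((n.choose l * l.choose i : R) * x ^ l)
  · refine Finset.sum_congr rfl fun k hk => Finset.sum_congr rfl fun l hl => ?_
    rw [Finset.mem_range] at hk hl
    rw [choose_add_eq_sum_choose_mul_choose (N := min m n) (by omega), pow_add]
    push_cast
    simp only [Finset.sum_mul]
    exact Finset.sum_congr rfl fun i _ => by ring
  · simp_rw [Finset.sum_comm (t := Finset.range (min m n + 1))]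
    refine Finset.sum_congr rfl fun i hi => ?_
    rw [Finset.mem_range] at hi
    rw [← Finset.sum_mul_sum, sum_range_choose_mul_choose_mul_pow_sub x (by omega),
      sum_range_choose_mul_choose_mul_pow x (by omega),
      show m + n - 2 * i = (m - i) + (n - i) by omega, pow_add]
    push_cast
    ring

end CommSemiring

/-! ### Palindromicity from γ-positivity -/

namespace PreorderPolytope

/-- Each `t^i * (1 + t)^(d - 2 * i)` is symmetric about degree `d / 2`. -/
theorem IsGammaPositive.isPalindromic {d : ℕ} {p : ℤ[X]} (hp : IsGammaPositive d p) :
    IsPalindromic d p := by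
  obtain ⟨γ, rfl⟩ := hp
  intro j hj
  simp only [finsetSum_coeff, mul_assoc, coeff_C_mul, coeff_X_pow_mul', coeff_one_add_X_pow]
  refine Finset.sum_congr rfl fun i hi => ?_
  rw [Finset.mem_range] at hi
  congr 1
  split_ifs with h₁ h₂ h₂
  · rw [← Nat.choose_symm (by omega : j - i ≤ d - 2 * i)]
    congr 2
    omega
  · rw [Nat.choose_eq_zero_of_lt (by omega), Nat.cast_zero]
  · rw [Nat.choose_eq_zero_of_lt (by omega), Nat.cast_zero]
  · rfl

theorem isGammaPositive_sum_choose_mul_choose (m n : ℕ) :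
    IsGammaPositive (m + n) (∑ i ∈ Finset.range (min m n + 1),
      C ((m.choose i * n.choose i : ℕ) : ℤ) * X ^ i * (1 + X) ^ (m + n - 2 * i)) := by
  refine ⟨fun i => m.choose i * n.choose i, Finset.sum_subset
    (Finset.range_subset_range.mpr (by omega)) fun i _ hi => ?_⟩
  have h : m < i ∨ n < i := by
    rw [Finset.mem_range] at hi
    omega
  rcases h with h | h <;> simp [Nat.choose_eq_zero_of_lt h]

end PreorderPolytope

/-! ### Real-rootedness -/

/-- Gauss–Lucas, iterated. Once a derivative is constant, the next is zero, whose `rootSet` is empty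
by convention. -/
theorem Polynomial.rootSet_iterate_derivative_subset {K : Set ℂ} (hK : Convex ℝ K) {p : ℂ[X]}
    (hp : p.rootSet ℂ ⊆ K) (k : ℕ) : (derivative^[k] p).rootSet ℂ ⊆ K := by
  induction k with
  | zero => exact hp
  | succ k ih =>
    rw [Function.iterate_succ_apply']
    rcases lt_or_ge 0 (derivative^[k] p).degree with h | h
    · exact (rootSet_derivative_subset_convexHull_rootSet h).trans (convexHull_min ih hK)
    · rw [eq_C_of_degree_le_zero h]
      simp

/-- Leibniz's rule, as in Rodrigues' formula for Jacobi polynomials. -/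
theorem iterate_derivative_X_add_one_pow_mul_X_pow (m n : ℕ) :
    derivative^[m] ((X + C 1 : ℂ[X]) ^ m * X ^ n) = (m.factorial : ℂ[X]) *
      ∑ i ∈ Finset.range (min m n + 1),
        ((m.choose i * n.choose i : ℕ) : ℂ[X]) * ((X + C 1) ^ i * X ^ (n - i)) := by
  rw [iterate_derivative_mul_X_pow, Finset.mul_sum, min_comm n m]
  refine Finset.sum_congr rfl fun i hi => ?_
  have hi : i ≤ m := by
    rw [Finset.mem_range] at hi
    omega
  have h : m.choose i * n.descFactorial i * m.descFactorial (m - i) =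
      m.factorial * (m.choose i * n.choose i) := by
    have h₁ := Nat.factorial_mul_descFactorial (Nat.sub_le m i)
    rw [Nat.sub_sub_self hi] at h₁
    rw [Nat.descFactorial_eq_factorial_mul_choose, ← h₁]
    ring
  rw [iterate_derivative_X_add_pow, Nat.sub_sub_self hi, nsmul_eq_mul, nsmul_eq_mul,
    ← mul_assoc (m.factorial : ℂ[X]), ← Nat.cast_mul, ← h]
  push_cast
  ring

theorem convex_segment_neg_one_zero : Convex ℝ {z : ℂ | z.im = 0 ∧ -1 ≤ z.re ∧ z.re ≤ 0} := by
  intro x hx y hy a b ha hb hab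
  simp only [Set.mem_ofPred_eq, Complex.add_im, Complex.add_re, Complex.real_smul,
    Complex.mul_re, Complex.mul_im, Complex.ofReal_re, Complex.ofReal_im] at *
  refine ⟨by rw [hx.1, hy.1]; ring, ?_, ?_⟩ <;> nlinarith

theorem sum_choose_mul_choose_mul_pow_eq_zero {m n : ℕ} {s : ℂ}
    (hs : ∑ i ∈ Finset.range (min m n + 1), ((m.choose i * n.choose i : ℕ) : ℂ) * s ^ i = 0) :
    s.im = 0 ∧ s.re ≤ 0 := by
  -- At `s = 1` all terms are nonnegative and the term `i = 0` is 1.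
  have hs1 : s - 1 ≠ 0 := by
    intro h
    rw [sub_eq_zero.mp h] at hs
    simp only [one_pow, mul_one] at hs
    rw [← Nat.cast_sum, Nat.cast_eq_zero, Finset.sum_eq_zero_iff] at hs
    simpa using hs 0 (by simp)
  set q : ℂ[X] := (X + C 1) ^ m * X ^ n with hq
  -- Solves `s = (x + 1) / x`.
  set x : ℂ := (s - 1)⁻¹ with hx
  have hx0 : x ≠ 0 := inv_ne_zero hs1
  have hsx : x + 1 = s * x := by
    rw [hx]
    field_simp
    ring
  have hmon : q.Monic := ((monic_X_add_C 1).pow m).mul (monic_X_pow n)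
  have hdeg : q.natDegree = m + n := by
    rw [hq, ((monic_X_add_C (1 : ℂ)).pow m).natDegree_mul (monic_X_pow n),
      natDegree_pow, natDegree_X_add_C, mul_one, natDegree_X_pow]
  -- The leading term of `q`, of degree `m + n`, survives `m` derivatives.
  have hD : derivative^[m] q ≠ 0 := by
    intro h
    have := congrArg (fun r : ℂ[X] => r.coeff n) h
    simp only [coeff_iterate_derivative, coeff_zero] at this
    rw [add_comm n m, ← hdeg, hmon.coeff_natDegree, hdeg, nsmul_eq_mul, mul_one,
      Nat.cast_eq_zero, Nat.descFactorial_eq_zero_iff_lt] at this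
    omega
  have hroots : q.rootSet ℂ ⊆ {z : ℂ | z.im = 0 ∧ -1 ≤ z.re ∧ z.re ≤ 0} := by
    intro z hz
    have hz := (mem_rootSet.mp hz).2
    simp only [hq, map_mul, map_pow, map_add, aeval_X, map_one, mul_eq_zero] at hz
    rcases hz with hz | hz
    · have hz := eq_zero_of_pow_eq_zero hz
      rw [eq_neg_of_add_eq_zero_left hz]
      simp
    · rw [eq_zero_of_pow_eq_zero hz]
      simp
  have hxK : x ∈ {z : ℂ | z.im = 0 ∧ -1 ≤ z.re ∧ z.re ≤ 0} := by
    refine rootSet_iterate_derivative_subset convex_segment_neg_one_zero hroots m ?_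
    refine mem_rootSet.mpr ⟨hD, ?_⟩
    rw [coe_aeval_eq_eval, hq, iterate_derivative_X_add_one_pow_mul_X_pow, eval_mul,
      eval_finsetSum]
    refine mul_eq_zero_of_right _ ?_
    trans x ^ n * ∑ i ∈ Finset.range (min m n + 1), ((m.choose i * n.choose i : ℕ) : ℂ) * s ^ i
    · rw [Finset.mul_sum]
      refine Finset.sum_congr rfl fun i hi => ?_
      rw [Finset.mem_range] at hi
      simp only [eval_mul, eval_pow, eval_add, eval_X, eval_C, eval_natCast, hsx, mul_pow]
      rw [show x ^ n = x ^ i * x ^ (n - i) by rw [← pow_add]; congr 1; omega]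
      ring
    · rw [hs, mul_zero]
  obtain ⟨him, hre, hre'⟩ := hxK
  have hxr : x = (x.re : ℂ) := Complex.ext rfl (by simpa using him)
  have hr0 : x.re ≠ 0 := fun h => hx0 (by rw [hxr, h, Complex.ofReal_zero])
  have hsr : s = ((1 + x.re⁻¹ : ℝ) : ℂ) := by
    push_cast
    rw [← hxr]
    field_simp
    rw [hsx, mul_comm]
  rw [hsr]
  refine ⟨Complex.ofReal_im _, ?_⟩
  rw [Complex.ofReal_re]
  have hneg : x.re < 0 := lt_of_le_of_ne hre' hr0
  have : x.re⁻¹ ≤ -1 := by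
    rw [inv_le_of_neg hneg (by norm_num)]
    simpa [inv_neg] using hre
  linarith

/-- If `t = a + b * I` with `b ≠ 0`, the imaginary part gives `2 * s * (1 + a) = 1`, so `1 + a < 0`;
the real part then gives `a = 1 - 2 * s * b^2 ≥ 1`, a contradiction. -/
theorem im_eq_zero_of_eq_mul_one_add_sq {t s : ℂ} (him : s.im = 0) (hre : s.re ≤ 0)
    (h : t = s * (1 + t) ^ 2) : t.im = 0 := by
  by_contra ht
  have h₁ := congrArg Complex.re h
  have h₂ := congrArg Complex.im h
  simp only [pow_two, Complex.mul_re, Complex.mul_im, Complex.add_re, Complex.add_im,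
    Complex.one_re, Complex.one_im, him] at h₁ h₂
  have h₃ : 2 * s.re * (1 + t.re) = 1 := mul_left_cancel₀ ht (by linarith)
  nlinarith [mul_nonneg (neg_nonneg.mpr hre) (sq_nonneg t.im)]

namespace PreorderPolytope

theorem isRealRooted_sum_choose_mul_choose (m n : ℕ) :
    IsRealRooted (∑ i ∈ Finset.range (min m n + 1),
      C ((m.choose i * n.choose i : ℕ) : ℤ) * X ^ i * (1 + X) ^ (m + n - 2 * i)) := by
  intro t ht
  -- The substitution for `s` divides by `1 + t`; the excluded point `t = -1` is real anyway.
  by_cases h1 : 1 + t = 0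
  · rw [eq_neg_of_add_eq_zero_right h1]
    simp
  set s : ℂ := t / (1 + t) ^ 2 with hs
  have hst : t = s * (1 + t) ^ 2 := by
    rw [hs]
    field_simp
  have hsum : (1 + t) ^ (m + n) *
      ∑ i ∈ Finset.range (min m n + 1), ((m.choose i * n.choose i : ℕ) : ℂ) * s ^ i = 0 := by
    rw [← ht, map_sum, Finset.mul_sum]
    refine Finset.sum_congr rfl fun i hi => ?_
    rw [Finset.mem_range] at hi
    simp only [map_mul, map_pow, map_add, map_one, aeval_X, aeval_C]
    rw [show (1 + t) ^ (m + n) = ((1 + t) ^ 2) ^ i * (1 + t) ^ (m + n - 2 * i) by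
      rw [← pow_mul, ← pow_add]; congr 1; omega]
    have hpow : t ^ i = s ^ i * ((1 + t) ^ 2) ^ i := by rw [← mul_pow, ← hst]
    rw [hpow, map_natCast]
    ring
  obtain ⟨him, hre⟩ := sum_choose_mul_choose_mul_pow_eq_zero
    ((mul_eq_zero.mp hsum).resolve_left (pow_ne_zero _ h1))
  exact im_eq_zero_of_eq_mul_one_add_sq him hre hst

end PreorderPolytope

/-! ### Stars and bars -/

theorem sum_antidiagonal_multichoose_snd (s n : ℕ) :
    ∑ p ∈ Finset.HasAntidiagonal.antidiagonal n, s.multichoose p.2 = (s + 1).multichoose n := by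
  induction n with
  | zero => simp
  | succ n ih =>
    rw [Finset.Nat.sum_antidiagonal_succ, ih, Nat.multichoose_succ_succ]

theorem Finset.card_piAntidiag_eq_multichoose {ι : Type*} [DecidableEq ι] (s : Finset ι) (n : ℕ) :
    (s.piAntidiag n).card = (s.card).multichoose n := by
  induction s using Finset.cons_induction generalizing n with
  | empty => cases n <;> simp
  | cons i s hi ih =>
    rw [piAntidiag_cons, card_disjiUnion, card_cons, ← sum_antidiagonal_multichoose_snd]
    exact sum_congr rfl fun p _ => by rw [card_map, ih]

/-! ### Lattice points of the ordinal sum and their encoding -/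

namespace PreorderPolytope

theorem hPolynomial_eq_sum_of_latticePoints_eq {E : Type*} [Preorder E] [Fintype E]
    [DecidableEq E] (F : Finset (E → ℤ)) (hF : latticePoints E = F) :
    hPolynomial E = ∑ a ∈ F, X ^ (Finset.univ.filter fun e => a e ≠ 0).card := by
  have h : ∀ i, hVector E i =
      (F.filter fun a => (Finset.univ.filter fun e => a e ≠ 0).card = i).card := by
    intro i
    rw [hVector, ← Set.ncard_coe_finset, hF]
    congr 1
    ext a
    simp
  rw [hPolynomial, ← Finset.sum_fiberwise_of_maps_to
    (g := fun a : E → ℤ => (Finset.univ.filter fun e => a e ≠ 0).card)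
    (t := Finset.range (Fintype.card E + 1))
    fun a _ => Finset.mem_range.mpr (Nat.lt_succ_of_le (Finset.card_le_univ _))]
  refine Finset.sum_congr rfl fun i _ => ?_
  rw [Finset.sum_congr rfl (g := fun _ => X ^ i), Finset.sum_const, h, nsmul_eq_mul]
  · simp
  · intro a ha
    rw [(Finset.mem_filter.mp ha).2]

section AntichainSum

variable {m n : ℕ}

/-- The `i`-th element of the lower antichain. -/
def lower (i : Fin m) : AntichainSum m n := toLex (Sum.inl i)

/-- The `j`-th element of the upper antichain. -/
def upper (j : Fin n) : AntichainSum m n := toLex (Sum.inr j)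

theorem forall_antichainSum {p : AntichainSum m n → Prop} :
    (∀ e, p e) ↔ (∀ i, p (lower i)) ∧ ∀ j, p (upper j) :=
  Sum.forall

theorem upper_injective : Function.Injective (upper : Fin n → AntichainSum m n) :=
  fun _ _ h => Sum.inr_injective h

theorem lower_ne_upper (i : Fin m) (j : Fin n) : (lower i : AntichainSum m n) ≠ upper j :=
  Sum.inl_ne_inr

theorem lower_le_lower {i i' : Fin m} : (lower i : AntichainSum m n) ≤ lower i' ↔ i = i' :=
  Sum.Lex.inl_le_inl_iff

theorem upper_le_upper {j j' : Fin n} : (upper j : AntichainSum m n) ≤ upper j' ↔ j = j' :=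
  Sum.Lex.inr_le_inr_iff

theorem lower_le_upper (i : Fin m) (j : Fin n) : (lower i : AntichainSum m n) ≤ upper j :=
  Sum.Lex.inl_le_inr _ _

theorem not_upper_le_lower (i : Fin m) (j : Fin n) : ¬(upper j : AntichainSum m n) ≤ lower i :=
  Sum.Lex.not_inr_le_inl

theorem sum_antichainSum {M : Type*} [AddCommMonoid M] (f : AntichainSum m n → M) :
    ∑ e, f e = ∑ i, f (lower i) + ∑ j, f (upper j) :=
  Fintype.sum_sum_type f

theorem sum_finset_antichainSum {M : Type*} [AddCommMonoid M] (I : Finset (AntichainSum m n))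
    (f : AntichainSum m n → M) :
    ∑ e ∈ I, f e = ∑ i ∈ Finset.univ.filter (fun i => lower i ∈ I), f (lower i) +
      ∑ j ∈ Finset.univ.filter (fun j => upper j ∈ I), f (upper j) := by
  rw [Finset.sum_filter, Finset.sum_filter,
    ← sum_antichainSum (fun e => if e ∈ I then f e else 0), ← Finset.sum_filter]
  simp

theorem card_finset_antichainSum (I : Finset (AntichainSum m n)) :
    I.card = (Finset.univ.filter fun i : Fin m => lower i ∈ I).card +
      (Finset.univ.filter fun j : Fin n => upper j ∈ I).card := by
  simp only [Finset.card_eq_sum_ones]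
  exact sum_finset_antichainSum I fun _ => 1

/-- An ideal meeting the upper antichain contains the whole lower one, so it is determined by its
upper part `J`. For any other ideal the inequality follows from those of lower singletons. -/
theorem mem_latticePoints_antichainSum {a : AntichainSum m n → ℤ} :
    a ∈ latticePoints (AntichainSum m n) ↔
      ((∀ i, 0 ≤ a (lower i)) ∧ ∀ j, 0 ≤ a (upper j)) ∧ (∀ i, a (lower i) ≤ 1) ∧
        ∀ J : Finset (Fin n), ∑ i, a (lower i) + ∑ j ∈ J, a (upper j) ≤ m + J.card := by
  have key : a ∈ latticePoints (AntichainSum m n) ↔ (∀ e, 0 ≤ a e) ∧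
      ∀ I : Finset (AntichainSum m n), IsLowerSet (I : Set (AntichainSum m n)) →
        ∑ e ∈ I, a e ≤ I.card := by
    simp only [latticePoints, polytope, Set.mem_ofPred_eq]
    refine and_congr (forall_congr' fun e => by norm_cast) (forall₂_congr fun I _ => ?_)
    norm_cast
  rw [key, forall_antichainSum]
  refine and_congr_right fun ⟨_, hpos⟩ =>
    ⟨fun h => ⟨fun i => ?_, fun J => ?_⟩, fun ⟨h₁, h₂⟩ I hI => ?_⟩
  · have := h {lower i} (by
      rw [Finset.coe_singleton]
      intro x y hyx hx
      rw [Set.mem_singleton_iff] at hx ⊢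
      subst hx
      revert y
      rw [forall_antichainSum]
      refine ⟨fun i' h => ?_, fun j h => absurd h (not_upper_le_lower _ _)⟩
      rw [lower_le_lower.mp h])
    simpa using this
  · let I : Finset (AntichainSum m n) := Finset.univ.image lower ∪ J.image upper
    have hl : ∀ i : Fin m, (lower i : AntichainSum m n) ∈ I := fun i =>
      Finset.mem_union_left _ (Finset.mem_image_of_mem _ (Finset.mem_univ i))
    have hu : ∀ j : Fin n, (upper j : AntichainSum m n) ∈ I ↔ j ∈ J := by
      intro j
      simp [I, lower_ne_upper, upper_injective.eq_iff]
    have := h I (by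
      intro x y
      simp only [Finset.mem_coe]
      revert x y
      rw [forall_antichainSum]
      simp only [forall_antichainSum, hl, hu, not_upper_le_lower, upper_le_upper]
      simp +contextual)
    rw [sum_finset_antichainSum, card_finset_antichainSum] at this
    simpa [hl, hu] using this
  · rw [sum_finset_antichainSum, card_finset_antichainSum]
    by_cases hJ : ∃ j : Fin n, (upper j : AntichainSum m n) ∈ I
    · obtain ⟨j, hj⟩ := hJ
      have hl : ∀ i : Fin m, (lower i : AntichainSum m n) ∈ I :=
        fun i => hI (lower_le_upper i j) hj
      simpa [hl] using h₂ (Finset.univ.filter fun j => upper j ∈ I)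
    · push Not at hJ
      simp only [hJ, Finset.filter_false, Finset.sum_empty, add_zero, Finset.card_empty]
      simpa using Finset.sum_le_card_nsmul
        (Finset.univ.filter fun i : Fin m => (lower i : AntichainSum m n) ∈ I)
        (fun i => a (lower i)) 1 fun i _ => h₁ i

/-- The data encoding the lattice points: the set `S` of zero coordinates in the lower antichain,
the set `T` of nonzero coordinates in the upper antichain, and the excesses over `1` of the
coordinates in `T` together with a slack variable, of total `|S|`. -/
def codes (m n : ℕ) :
    Finset (Σ _ : Finset (Fin m) × Finset (Fin n), Option (Fin n) → ℕ) :=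
  Finset.univ.sigma fun p => (Finset.insertNone p.2).piAntidiag p.1.card

/-- The lattice point with a given code. -/
def decode (p : Σ _ : Finset (Fin m) × Finset (Fin n), Option (Fin n) → ℕ) :
    AntichainSum m n → ℤ := fun e =>
  Sum.elim (fun i : Fin m => if i ∈ p.1.1 then 0 else 1)
    (fun j : Fin n => if j ∈ p.1.2 then (p.2 (some j) : ℤ) + 1 else 0) (ofLex e)

theorem decode_lower (p : Σ _ : Finset (Fin m) × Finset (Fin n), Option (Fin n) → ℕ)
    (i : Fin m) : decode p (lower i) = if i ∈ p.1.1 then 0 else 1 := rfl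

theorem decode_upper (p : Σ _ : Finset (Fin m) × Finset (Fin n), Option (Fin n) → ℕ)
    (j : Fin n) : decode p (upper j) = if j ∈ p.1.2 then (p.2 (some j) : ℤ) + 1 else 0 := rfl

theorem mem_codes {S : Finset (Fin m)} {T : Finset (Fin n)} {c : Option (Fin n) → ℕ} :
    ⟨(S, T), c⟩ ∈ codes m n ↔
      c none + ∑ j ∈ T, c (some j) = S.card ∧ ∀ j ∉ T, c (some j) = 0 := by
  rw [codes, Finset.mem_sigma, Finset.mem_piAntidiag, Finset.sum_insertNone]
  simp only [Finset.mem_univ, true_and]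
  refine and_congr_right fun _ => ⟨fun h j hj => ?_, fun h e he => ?_⟩
  · by_contra hc
    exact hj (Finset.some_mem_insertNone.mp (h _ hc))
  · cases e with
    | none => simp
    | some j => exact Finset.some_mem_insertNone.mpr (not_imp_comm.mp (h j) he)

/-- Zeros and supports recover `S` and `T`, values on `T` the excesses, and the fixed total `|S|`
the slack. -/
theorem decode_injOn : Set.InjOn (decode : _ → AntichainSum m n → ℤ) (codes m n) := by
  rintro ⟨⟨S, T⟩, c⟩ hp ⟨⟨S', T'⟩, c'⟩ hp' h
  rw [Finset.mem_coe, mem_codes] at hp hp'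
  have hS : S = S' := by
    ext i
    have := congrFun h (lower i)
    simp only [decode_lower] at this
    split_ifs at this <;> simp_all
  have hT : T = T' := by
    ext j
    have := congrFun h (upper j)
    simp only [decode_upper] at this
    split_ifs at this
    · simp_all
    · omega
    · omega
    · simp_all
  subst hS hT
  have hc : ∀ j, c (some j) = c' (some j) := by
    intro j
    by_cases hj : j ∈ T
    · have := congrFun h (upper j)
      simp only [decode_upper, if_pos hj] at this
      omega
    · rw [hp.2 j hj, hp'.2 j hj]
  have hcc : c = c' := by
    funext e
    cases e with
    | none =>
      have h₁ := hp.1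
      rw [← hp'.1, Finset.sum_congr rfl fun j _ => hc j] at h₁
      exact Nat.add_right_cancel h₁
    | some j => exact hc j
  rw [hcc]

theorem sum_ite_mem_zero_one (S : Finset (Fin m)) :
    ∑ i, (if i ∈ S then (0 : ℤ) else 1) = m - S.card := by
  have h : ∀ i, (if i ∈ S then (0 : ℤ) else 1) = 1 - if i ∈ S then 1 else 0 := fun i => by
    split_ifs <;> rfl
  simp [h]

theorem decode_mem_latticePoints {p : Σ _ : Finset (Fin m) × Finset (Fin n), Option (Fin n) → ℕ}
    (hp : p ∈ codes m n) : decode p ∈ latticePoints (AntichainSum m n) := by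
  obtain ⟨⟨S, T⟩, c⟩ := p
  obtain ⟨hsum, -⟩ := mem_codes.mp hp
  rw [mem_latticePoints_antichainSum]
  simp only [decode_lower, decode_upper]
  refine ⟨⟨fun i => by split_ifs <;> simp, fun j => by split_ifs <;> positivity⟩,
    fun i => by split_ifs <;> simp, fun J => ?_⟩
  rw [sum_ite_mem_zero_one]
  -- Each `j ∈ J` contributes at most 1 plus its excess; the excesses total at most `|S|`, which the
  -- lower sum `m - |S|` leaves free.
  have h₁ : ∑ j ∈ J, (if j ∈ T then (c (some j) : ℤ) + 1 else 0) ≤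
      ∑ j ∈ J, ((if j ∈ T then (c (some j) : ℤ) else 0) + 1) :=
    Finset.sum_le_sum fun j _ => by split_ifs <;> simp
  have h₂ : ∑ j ∈ J, (if j ∈ T then (c (some j) : ℤ) else 0) ≤ ∑ j ∈ T, (c (some j) : ℤ) := by
    rw [← Finset.sum_filter]
    exact Finset.sum_le_sum_of_subset_of_nonneg (fun j hj => (Finset.mem_filter.mp hj).2)
      fun j _ _ => by positivity
  rw [Finset.sum_add_distrib, Finset.sum_const, nsmul_one] at h₁
  have h₃ : (c none : ℤ) + ∑ j ∈ T, (c (some j) : ℤ) = S.card := by exact_mod_cast hsum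
  have h₄ : (0 : ℤ) ≤ c none := by positivity
  linarith

theorem exists_decode_eq {a : AntichainSum m n → ℤ}
    (ha : a ∈ latticePoints (AntichainSum m n)) : ∃ p ∈ codes m n, decode p = a := by
  obtain ⟨⟨hl, hu⟩, hle, hsum⟩ := mem_latticePoints_antichainSum.mp ha
  set S : Finset (Fin m) := Finset.univ.filter fun i => a (lower i) = 0 with hS
  set T : Finset (Fin n) := Finset.univ.filter fun j => a (upper j) ≠ 0 with hT
  have hlow : ∀ i, a (lower i) = if i ∈ S then 0 else 1 := by
    intro i
    have := hl i
    have := hle i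
    simp only [hS, Finset.mem_filter, Finset.mem_univ, true_and]
    split_ifs <;> omega
  have hmT : ∀ j, j ∈ T ↔ a (upper j) ≠ 0 := fun j => by simp [hT]
  have hexc : ∀ j ∈ T, ((a (upper j) - 1).toNat : ℤ) = a (upper j) - 1 := by
    intro j hj
    have := hu j
    have := (hmT j).mp hj
    omega
  -- The single inequality `J = T` is the binding one.
  have hslack : ∑ j ∈ T, (a (upper j) - 1).toNat ≤ S.card := by
    zify
    rw [Finset.sum_congr rfl hexc, Finset.sum_sub_distrib, Finset.sum_const, nsmul_one]
    have := hsum T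
    rw [Finset.sum_congr rfl fun i _ => hlow i, sum_ite_mem_zero_one] at this
    linarith
  refine ⟨⟨(S, T), fun e => e.elim (S.card - ∑ j ∈ T, (a (upper j) - 1).toNat)
    fun j => (a (upper j) - 1).toNat⟩, mem_codes.mpr ⟨Nat.sub_add_cancel hslack, ?_⟩, ?_⟩
  · intro j hj
    have := hmT j
    simp only [Option.elim]
    have : a (upper j) = 0 := by tauto
    simp [this]
  · funext e
    revert e
    rw [forall_antichainSum]
    refine ⟨fun i => (hlow i).symm, fun j => ?_⟩
    rw [decode_upper]
    split_ifs with hj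
    · simp only [Option.elim]
      rw [hexc j hj, sub_add_cancel]
    · have := hmT j
      tauto

theorem latticePoints_antichainSum_eq_image :
    latticePoints (AntichainSum m n) = ((codes m n).image decode : Finset _) := by
  ext a
  rw [Finset.coe_image]
  constructor
  · exact exists_decode_eq
  · rintro ⟨p, hp, rfl⟩
    exact decode_mem_latticePoints hp

theorem card_filter_decode_ne_zero
    (p : Σ _ : Finset (Fin m) × Finset (Fin n), Option (Fin n) → ℕ) :
    (Finset.univ.filter fun e => decode p e ≠ 0).card = m - p.1.1.card + p.1.2.card := by
  rw [card_finset_antichainSum]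
  have hl : (Finset.univ.filter fun i : Fin m =>
      lower i ∈ Finset.univ.filter fun e => decode p e ≠ 0) = p.1.1ᶜ := by
    ext i
    simp [decode_lower]
  have hu : (Finset.univ.filter fun j : Fin n =>
      upper j ∈ Finset.univ.filter fun e => decode p e ≠ 0) = p.1.2 := by
    ext j
    simp only [Finset.mem_filter, Finset.mem_univ, true_and, decode_upper]
    split_ifs with h
    · simp only [h, iff_true]
      positivity
    · simp [h]
  rw [hl, hu, Finset.card_compl, Fintype.card_fin]

/-- The number of codes over `(S, T)` depends only on the two cardinalities, so it suffices to group
subsets by size. -/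
theorem sum_codes {M : Type*} [AddCommMonoid M] (f : ℕ → ℕ → M) :
    ∑ p ∈ codes m n, f p.1.1.card p.1.2.card = ∑ k ∈ Finset.range (m + 1),
      ∑ l ∈ Finset.range (n + 1), ((k + l).choose k * m.choose k * n.choose l) • f k l := by
  rw [codes, Finset.sum_sigma, ← Finset.univ_product_univ, Finset.sum_product]
  have h : ∀ (S : Finset (Fin m)) (T : Finset (Fin n)),
      ((Finset.insertNone T).piAntidiag S.card).card = (S.card + T.card).choose S.card := by
    intro S T
    rw [Finset.card_piAntidiag_eq_multichoose, Finset.card_insertNone, Nat.multichoose_eq]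
    congr 1
    omega
  simp only [Finset.sum_const, h]
  have hT : ∀ k, ∑ T : Finset (Fin n), (k + T.card).choose k • f k T.card =
      ∑ l ∈ Finset.range (n + 1), n.choose l • (k + l).choose k • f k l := by
    intro k
    rw [← Finset.powerset_univ, Finset.sum_powerset_apply_card
      (fun l => (k + l).choose k • f k l), Finset.card_univ, Fintype.card_fin]
  simp only [hT]
  rw [← Finset.powerset_univ, Finset.sum_powerset_apply_card
    (fun k => ∑ l ∈ Finset.range (n + 1), n.choose l • (k + l).choose k • f k l),
    Finset.card_univ, Fintype.card_fin]
  refine Finset.sum_congr rfl fun k _ => ?_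
  rw [Finset.smul_sum]
  refine Finset.sum_congr rfl fun l _ => ?_
  rw [smul_smul, smul_smul]
  congr 1
  ring

theorem ncard_latticePoints_antichainSum (m n : ℕ) :
    (latticePoints (AntichainSum m n)).ncard = ∑ k ∈ Finset.range (m + 1),
      ∑ l ∈ Finset.range (n + 1), (k + l).choose k * m.choose k * n.choose l := by
  rw [latticePoints_antichainSum_eq_image, Set.ncard_coe_finset,
    Finset.card_image_of_injOn decode_injOn, Finset.card_eq_sum_ones,
    sum_codes (fun _ _ => 1)]
  simp

theorem hPolynomial_antichainSum (m n : ℕ) :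
    hPolynomial (AntichainSum m n) = ∑ k ∈ Finset.range (m + 1), ∑ l ∈ Finset.range (n + 1),
      C (((k + l).choose k * m.choose k * n.choose l : ℕ) : ℤ) * X ^ (m - k + l) := by
  rw [hPolynomial_eq_sum_of_latticePoints_eq _ latticePoints_antichainSum_eq_image,
    Finset.sum_image decode_injOn]
  simp only [card_filter_decode_ne_zero]
  rw [sum_codes (fun k l => (X : ℤ[X]) ^ (m - k + l))]
  simp

end AntichainSum

end PreorderPolytope

theorem proposition8p2 (m n : ℕ) (hm : 0 < m) (hn : 0 < n) :
    (PreorderPolytope.latticePoints (PreorderPolytope.AntichainSum m n)).ncard =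
        ∑ k ∈ Finset.range (m + 1), ∑ l ∈ Finset.range (n + 1),
          (k + l).choose k * m.choose k * n.choose l ∧
    ((PreorderPolytope.latticePoints (PreorderPolytope.AntichainSum m n)).ncard : ℤ) =
        (PreorderPolytope.hPolynomial (PreorderPolytope.AntichainSum m n)).eval 1 ∧
    PreorderPolytope.hPolynomial (PreorderPolytope.AntichainSum m n) =
        ∑ k ∈ Finset.range (m + 1), ∑ l ∈ Finset.range (n + 1),
          C (((k + l).choose k * m.choose k * n.choose l : ℕ) : ℤ) * X ^ (m - k + l) ∧
    PreorderPolytope.hPolynomial (PreorderPolytope.AntichainSum m n) =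
        ∑ i ∈ Finset.range (min m n + 1),
          C ((m.choose i * n.choose i : ℕ) : ℤ) * X ^ i * (1 + X) ^ (m + n - 2 * i) ∧
    PreorderPolytope.IsPalindromic (m + n)
      (PreorderPolytope.hPolynomial (PreorderPolytope.AntichainSum m n)) ∧
    PreorderPolytope.IsGammaPositive (m + n)
      (PreorderPolytope.hPolynomial (PreorderPolytope.AntichainSum m n)) ∧
    PreorderPolytope.IsRealRooted
      (PreorderPolytope.hPolynomial (PreorderPolytope.AntichainSum m n)) := by
  have hγ : PreorderPolytope.hPolynomial (PreorderPolytope.AntichainSum m n) =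
      ∑ i ∈ Finset.range (min m n + 1),
        C ((m.choose i * n.choose i : ℕ) : ℤ) * X ^ i * (1 + X) ^ (m + n - 2 * i) := by
    rw [PreorderPolytope.hPolynomial_antichainSum]
    simpa using sum_choose_mul_pow_eq_sum_mul_one_add_pow (X : ℤ[X]) m n
  have hpos := hγ ▸ PreorderPolytope.isGammaPositive_sum_choose_mul_choose m n
  refine ⟨PreorderPolytope.ncard_latticePoints_antichainSum m n, ?_,
    PreorderPolytope.hPolynomial_antichainSum m n, hγ, hpos.isPalindromic, hpos,
    hγ ▸ PreorderPolytope.isRealRooted_sum_choose_mul_choose m n⟩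
  rw [PreorderPolytope.ncard_latticePoints_antichainSum,
    PreorderPolytope.hPolynomial_antichainSum]
  simp [eval_finsetSum]
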